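/- **Theorem 4.** A qubit preparation is a finite convex decomposition $\rho=\sum_i p_i|\psi_i\rangle\langle\psi_i|$ into pure states of $\mathbb{C}^2$. For $n\ge 1$ preparations $\rho_1,\dots,\rho_n$, the common quantum overlap is $\omega_Q^{[n]}=n(1-A_Q^{[n]})$, where $A_Q^{[n]}=\max_{M}\frac1n\sum_{x}\sum_{k\ne x}\operatorname{Tr}(M_k\rho_x)$, the maximum being over all $n$-outcome POVMs $M$. Given a class of measurements, an ontological model consists of a space $\Lambda$ of ontic states with a reference measure $d\lambda$, a probability density $\mu(\cdot|\psi)$ for every pure state $\psi$, extended to preparations by $\mu(\lambda|\rho)=\sum_i p_i\,\mu(\lambda|\psi_i)$, and, for each measurement $M$ of the class, response functions $\xi(k|M,\lambda)\ge 0$ with $\sum_k\xi(k|M,\lambda)=1$ such that $\int_\Lambda\mu(\lambda|\rho)\,\xi(k|M,\lambda)\,d\lambda=\operatorname{Tr}(M_k\rho)$ for all outcomes $k$ and all preparations $\rho$. The common epistemic overlap in such a model is $\omega_E^{[n]}=\int_\Lambda\min_k\mu(\lambda|\rho_k)\,d\lambda$. The family $(\rho_k)_{k=1}^n$ is fully non-epistemic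 if $\omega_Q^{[n]}=1$ while $\omega_E^{[n]}=0$ in every ontological model. Let $n\ge 1$ and let $\rho_1,\dots,\rho_n$ be qubit preparations. Then $(\rho_k)_{k=1}^n$ is not fully non-epistemic, neither with respect to ontological models for all POVMs nor with respect to ontological models for projective measurements. Moreover, the Kochen–Specker model, in which $\Lambda$ is the unit sphere of $\mathbb{R}^3$ with its surface measure and $\mu(\vec\lambda|\psi)=\frac1\pi\max(0,\vec v\cdot\vec\lambda)$ for the pure state $\psi$ with Bloch vector $\vec v$, is an ontological model for projective qubit measurements, and if $\omega_Q^{[n]}(\rho_1,\dots,\rho_n)=1$, then $\omega_E^{[n]}(\rho_1,\dots,\rho_n)>0$ in the Kochen–Specker model. -/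

import Mathlib

open scoped NNReal ENNReal Matrix ComplexOrder

noncomputable section

/-- A pure quantum state of dimension `d`, i.e. a projector `|ψ⟩⟨ψ|` onto a unit vector `ψ`
(global phases are thereby identified). -/
def PureState (d : ℕ) : Type :=
  {ρ : Matrix (Fin d) (Fin d) ℂ //
    ∃ ψ : Fin d → ℂ, star ψ ⬝ᵥ ψ = 1 ∧ ρ = Matrix.vecMulVec ψ (star ψ)}

/-- The projector `|ψ⟩⟨ψ|` of a pure state. -/
def PureState.matrix {d : ℕ} (ψ : PureState d) : Matrix (Fin d) (Fin d) ℂ := ψ.1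

/-- A (mixed) preparation: one particular finite convex decomposition into pure states. -/
structure Preparation (d : ℕ) where
  /-- number of terms of the decomposition -/
  size : ℕ
  /-- convex coefficients -/
  weight : Fin size → ℝ≥0
  /-- the pure states that are mixed -/
  state : Fin size → PureState d
  sum_weight : ∑ i, weight i = 1

/-- The density matrix (mixed state) prepared by a preparation. -/
def Preparation.densityMatrix {d : ℕ} (P : Preparation d) : Matrix (Fin d) (Fin d) ℂ :=
  ∑ i, ((P.weight i : ℝ) : ℂ) • (P.state i).matrix

/-- A quantum measurement (POVM) with `k` outcomes in dimension `d`. -/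
structure POVM (d k : ℕ) where
  effect : Fin k → Matrix (Fin d) (Fin d) ℂ
  posSemidef : ∀ i, (effect i).PosSemidef
  sum_effect : ∑ i, effect i = 1

/-- A measurement is projective if all its effects are orthogonal projections. -/
def POVM.IsProjective {d k : ℕ} (M : POVM d k) : Prop :=
  ∀ i, M.effect i * M.effect i = M.effect i

/-- Born rule: the probability `p(x | M, ρ) = Tr(M_x ρ)`. -/
def bornProb {d k : ℕ} (M : POVM d k) (P : Preparation d) (x : Fin k) : ℝ :=
  (Matrix.trace (M.effect x * P.densityMatrix)).re

/-- Anti-distinguishability of `n` preparations: the best average, over all `n`-outcome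
measurements, of the probability that the outcome differs from the label of the preparation. -/
def antiDistinguishability {d n : ℕ} (P : Fin n → Preparation d) : ℝ :=
  ⨆ M : POVM d n, (1 / (n : ℝ)) * ∑ x, ∑ k ∈ Finset.univ.erase x, bornProb M (P x) k

/-- Common quantum overlap `ω_Q = n (1 - A_Q)`. -/
def quantumOverlap {d n : ℕ} (P : Fin n → Preparation d) : ℝ :=
  (n : ℝ) * (1 - antiDistinguishability P)

/-- The data of the preparations in an ontological model: an ontic state space with a reference
measure `dλ`, and for every pure state `ψ` a density `μ(λ | ψ)`. The laws are in
`EpistemicModel.IsOntologicalModel`. -/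
structure EpistemicModel (d : ℕ) where
  Ontic : Type
  measurableSpace : MeasurableSpace Ontic
  reference : @MeasureTheory.Measure Ontic measurableSpace
  density : PureState d → Ontic → ℝ≥0

attribute [instance] EpistemicModel.measurableSpace

/-- The epistemic state of a mixed preparation, the corresponding convex mixture
`μ(λ | ρ) = ∑ i, p_i μ(λ | ψ_i)`. -/
def EpistemicModel.prepDensity {d : ℕ} (E : EpistemicModel d) (P : Preparation d)
    (l : E.Ontic) : ℝ≥0 :=
  ∑ i, P.weight i * E.density (P.state i) l

/-- Common epistemic overlap `∫ min_k μ(λ | ρ_k) dλ`. -/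
def EpistemicModel.overlap {d n : ℕ} (E : EpistemicModel d) (P : Fin n → Preparation d) : ℝ≥0∞ :=
  ∫⁻ l, ⨅ k, (E.prepDensity (P k) l : ℝ≥0∞) ∂E.reference

/-- `E` has a response scheme `ξ(x | M, λ)` for the measurement `M` that reproduces the
quantum probabilities of all preparations. -/
def EpistemicModel.Reproduces {d k : ℕ} (E : EpistemicModel d) (M : POVM d k) : Prop :=
  ∃ ξ : Fin k → E.Ontic → ℝ≥0,
    (∀ x, Measurable (ξ x)) ∧ (∀ l, ∑ x, ξ x l = 1) ∧
    ∀ (P : Preparation d) (x : Fin k),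
      ∫⁻ l, (E.prepDensity P l : ℝ≥0∞) * (ξ x l : ℝ≥0∞) ∂E.reference
        = ENNReal.ofReal (bornProb M P x)

/-- `E` is an ontological model for quantum theory in dimension `d` with the class `𝓜` of
measurements: the epistemic states are probability densities, and the statistics of every
measurement in `𝓜` is reproduced by a response scheme. -/
structure EpistemicModel.IsOntologicalModel {d : ℕ} (E : EpistemicModel d)
    (𝓜 : ∀ k, Set (POVM d k)) : Prop where
  measurable_density : ∀ ψ, Measurable (E.density ψ)
  lintegral_density : ∀ ψ, ∫⁻ l, (E.density ψ l : ℝ≥0∞) ∂E.reference = 1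
  reproduces : ∀ (k : ℕ) (M : POVM d k), M ∈ 𝓜 k → E.Reproduces M

/-- A family of preparations is fully non-epistemic (with respect to ontological models for the
measurements in `𝓜`) if its common quantum overlap is `1`, while its common epistemic overlap
vanishes in all ontological models. -/
def FullyNonEpistemic {d n : ℕ} (𝓜 : ∀ k, Set (POVM d k)) (P : Fin n → Preparation d) : Prop :=
  quantumOverlap P = 1 ∧
    ∀ E : EpistemicModel d, E.IsOntologicalModel 𝓜 → E.overlap P = 0

/-- The class of all measurements (POVMs). -/
def allMeasurements (d : ℕ) : ∀ k, Set (POVM d k) := fun _ => Set.univ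

/-- The class of projective measurements. -/
def projectiveMeasurements (d : ℕ) : ∀ k, Set (POVM d k) := fun _ => {M | M.IsProjective}

/-- The Bloch vector `(Tr(ψ σ_x), Tr(ψ σ_y), Tr(ψ σ_z))` of a pure qubit state. -/
def blochVector (ψ : PureState 2) : EuclideanSpace ℝ (Fin 3) :=
  !₂[(Matrix.trace (ψ.matrix * !![0, 1; 1, 0])).re,
     (Matrix.trace (ψ.matrix * !![0, -Complex.I; Complex.I, 0])).re,
     (Matrix.trace (ψ.matrix * !![1, 0; 0, -1])).re]

/-- The Kochen–Specker model of a qubit: the ontic states are the unit vectors `λ` of `ℝ³` with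
the surface measure of the sphere, and the pure state with Bloch vector `v` has the density
`(1/π) Θ(v·λ) v·λ`, where `Θ(t) t = max 0 t`. -/
def kochenSpecker : EpistemicModel 2 where
  Ontic := Metric.sphere (0 : EuclideanSpace ℝ (Fin 3)) 1
  measurableSpace := inferInstance
  reference := (MeasureTheory.volume : MeasureTheory.Measure (EuclideanSpace ℝ (Fin 3))).toSphere
  density := fun ψ l =>
    Real.toNNReal ((1 / Real.pi) *
      max 0 (inner ℝ (blochVector ψ) (l : EuclideanSpace ℝ (Fin 3))))

end

/-! If two of the preparations had different mean Bloch vectors, the spin measurement along their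
difference would push `∑ x, p(x | M, ρ_x)` below 1. So quantum overlap 1 forces a common mean Bloch
vector `r` (`meanBloch_eq_of_quantumOverlap_eq_one`). For almost every `l` with `r · l ≥ 0`, an
average of the numbers `v_i · l` is nonnegative, so in each preparation some component of nonzero
weight has `v_i · l > 0`. Such `l` have positive measure (`frequently_exists_inner_pos`).

For projective measurements this is enough: the Kochen–Specker density of each preparation is
positive at these `l`. That the model is valid rests on the hemisphere integral
`integral_hemisphere_max_inner`, which is the Born rule.

For POVMs another model is needed. One such `l` selects a pure state from each preparation, all in
one open hemisphere. In these finitely many states every POVM has outcome distributions with a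
common part of mass at least a fixed `ε > 0` (`exists_common_outcome_bound`). Hence these states can
share one ontic state with probability `ε`, the remaining probability staying on a private ontic
state (`sharedStateModel`). -/

open MeasureTheory Metric Set

/-! ### Symmetry, null sets and polar coordinates for the surface measure -/

section SphereMeasure

variable {E : Type*} [NormedAddCommGroup E] [InnerProductSpace ℝ E]

/-- The action of a linear isometry on the unit sphere. -/
def sphereIsometry (R : E ≃ₗᵢ[ℝ] E) (l : sphere (0 : E) 1) : sphere (0 : E) 1 :=
  ⟨R l, by simp⟩

@[simp]
theorem coe_sphereIsometry (R : E ≃ₗᵢ[ℝ] E) (l : sphere (0 : E) 1) :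
    (sphereIsometry R l : E) = R l := rfl

variable [FiniteDimensional ℝ E] [MeasurableSpace E] [BorelSpace E]

open scoped Pointwise in
-- `toSphere` measures a set by the volume of the cone over it, up to a constant; a linear isometry
-- preserves volume and maps cones to cones.
theorem measurePreserving_sphereIsometry (R : E ≃ₗᵢ[ℝ] E) :
    MeasurePreserving (sphereIsometry R) (volume : Measure E).toSphere
      (volume : Measure E).toSphere := by
  have hm : Measurable (sphereIsometry R) :=
    ((R.continuous.comp continuous_subtype_val).subtype_mk _).measurable
  refine ⟨hm, Measure.ext fun s hs => ?_⟩
  rw [Measure.map_apply hm hs, Measure.toSphere_apply' _ (hm hs), Measure.toSphere_apply' _ hs]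
  congr 1
  rw [← R.measurePreserving.measure_preimage_equiv (f := R.toMeasurableEquiv)
    (Ioo (0 : ℝ) 1 • (Subtype.val '' s))]
  congr 1
  ext x
  simp only [mem_smul, mem_image, mem_preimage, LinearIsometryEquiv.coe_toMeasurableEquiv]
  constructor
  · rintro ⟨r, hr, _, ⟨l, hl, rfl⟩, rfl⟩
    exact ⟨r, hr, R l, ⟨_, hl, rfl⟩, by simp⟩
  · rintro ⟨r, hr, _, ⟨l, hl, rfl⟩, h⟩
    refine ⟨r, hr, R.symm l, ⟨sphereIsometry R.symm l, ?_, rfl⟩, ?_⟩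
    · have : sphereIsometry R (sphereIsometry R.symm l) = l := Subtype.ext (by simp)
      simpa [this] using hl
    · apply R.injective
      simp [h]

theorem integral_comp_sphereIsometry (R : E ≃ₗᵢ[ℝ] E) (f : E → ℝ) :
    ∫ l, f (R l) ∂(volume : Measure E).toSphere = ∫ l, f l ∂(volume : Measure E).toSphere := by
  have hemb : MeasurableEmbedding (sphereIsometry R) := by
    refine (Topology.IsClosedEmbedding.measurableEmbedding ?_)
    refine Continuous.isClosedEmbedding
      ((R.continuous.comp continuous_subtype_val).subtype_mk _) ?_
    intro a b h
    exact Subtype.ext (R.injective (congrArg Subtype.val h))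
  exact (measurePreserving_sphereIsometry R).integral_comp hemb fun l => f l

/-- Great subspheres are null sets of the surface measure. -/
theorem toSphere_inner_eq_zero {v : E} (hv : v ≠ 0) :
    (volume : Measure E).toSphere {l | inner ℝ v (l : E) = 0} = 0 := by
  have hm : MeasurableSet {l : sphere (0 : E) 1 | inner ℝ v (l : E) = 0} :=
    (isClosed_eq (by fun_prop) continuous_const).measurableSet
  rw [Measure.toSphere_apply' _ hm]
  -- The cone over the great subsphere lies in the hyperplane orthogonal to `v`.
  refine mul_eq_zero_of_right _ (measure_mono_null ?_
    (Measure.addHaar_submodule volume (LinearMap.ker (innerₛₗ ℝ v)) ?_))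
  · rintro _ ⟨r, -, _, ⟨l, hl, rfl⟩, rfl⟩
    have hl' : inner ℝ v (l : E) = 0 := hl
    simp [hl']
  · intro h
    have : v ∈ LinearMap.ker (innerₛₗ ℝ v) := h ▸ Submodule.mem_top
    simp [hv] at this

theorem integrable_toSphere_of_continuous {f : E → ℝ} (hf : Continuous f) :
    Integrable (fun l : sphere (0 : E) 1 => f l) (volume : Measure E).toSphere :=
  BoundedContinuousFunction.integrable _
    (BoundedContinuousFunction.mkOfCompact ⟨_, hf.comp continuous_subtype_val⟩)

/-- Integration in polar coordinates of a product of an angular and a radial function. -/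
theorem integral_polar [Nontrivial E] (f : E → ℝ) (g : ℝ → ℝ) (h : E → ℝ)
    (hh : ∀ (r : ℝ) (l : E), 0 < r → ‖l‖ = 1 → h (r • l) = f l * g r) :
    ∫ x, h x = (∫ l, f l ∂(volume : Measure E).toSphere) *
      ∫ r in Ioi (0 : ℝ), r ^ (Module.finrank ℝ E - 1) * g r := by
  calc
    ∫ x, h x = ∫ x : ({(0)}ᶜ : Set E), h x ∂((volume : Measure E).comap (↑)) := by
      rw [integral_subtype_comap (measurableSet_singleton _).compl h, restrict_compl_singleton]
    _ = ∫ x, f x.1 * g x.2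
        ∂(volume : Measure E).toSphere.prod (.volumeIoiPow (Module.finrank ℝ E - 1)) := by
      rw [← (volume : Measure E).measurePreserving_homeomorphUnitSphereProd.integral_comp
        (Homeomorph.measurableEmbedding _) (fun x => f x.1 * g x.2)]
      refine integral_congr_ae (.of_forall fun x => ?_)
      have hx : (0 : ℝ) < ‖(x : E)‖ := norm_pos_iff.2 x.2
      have := hh ‖(x : E)‖ (‖(x : E)‖⁻¹ • (x : E)) hx (by simp [norm_smul, hx.ne'])
      simpa [smul_smul, hx.ne'] using this
    _ = (∫ l, f l ∂(volume : Measure E).toSphere) *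
        ∫ r : Ioi (0 : ℝ), g r ∂.volumeIoiPow (Module.finrank ℝ E - 1) :=
      integral_prod_mul (fun l : sphere (0 : E) 1 => f l) (fun r : Ioi (0 : ℝ) => g r)
    _ = _ := by
      simp only [Measure.volumeIoiPow, ENNReal.ofReal]
      rw [integral_withDensity_eq_integral_smul,
        integral_subtype_comap measurableSet_Ioi
          fun a ↦ Real.toNNReal (a ^ (Module.finrank ℝ E - 1)) • g a,
        setIntegral_congr_fun measurableSet_Ioi fun x hx ↦ ?_]
      · rw [NNReal.smul_def, Real.coe_toNNReal _ (pow_nonneg hx.out.le _), smul_eq_mul]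
      · exact (measurable_subtype_coe.pow_const _).real_toNNReal

end SphereMeasure

/-! ### Integrals of linear functions over the 2-sphere and its hemispheres -/

section TwoSphere

/-- Euclidean three-space. -/
abbrev E₃ : Type := EuclideanSpace ℝ (Fin 3)

theorem integral_abs_mul_exp_neg_sq : ∫ x : ℝ, |x| * Real.exp (-x ^ 2) = 1 := by
  have h := integral_rpow_mul_exp_neg_rpow (p := 2) (q := 1) (by norm_num) (by norm_num)
  have h2 := integral_comp_abs (f := fun x => x * Real.exp (-x ^ 2))
  simp only [sq_abs] at h2
  rw [h2]
  have : ∫ x in Ioi (0 : ℝ), x * Real.exp (-x ^ 2) = 1 / 2 := by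
    norm_num at h
    simpa using h
  rw [this]; norm_num

theorem integral_cube_mul_exp_neg_sq :
    ∫ x in Ioi (0 : ℝ), x ^ 3 * Real.exp (-x ^ 2) = 1 / 2 := by
  have h := integral_rpow_mul_exp_neg_rpow (p := 2) (q := 3) (by norm_num) (by norm_num)
  norm_num at h
  have h3 : ∀ x : ℝ, x ^ (3 : ℝ) = x ^ 3 := fun x => by exact_mod_cast Real.rpow_natCast x 3
  simpa [h3] using h

/-- The Gaussian factor makes the integrand a product over the coordinates, with value `1 · √π ·
√π`. Polar coordinates then turn this into an integral over the sphere. -/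
theorem integral_abs_coord_mul_exp_neg_norm_sq :
    ∫ x : E₃, |x 0| * Real.exp (-‖x‖ ^ 2) = Real.pi := by
  rw [← (PiLp.volume_preserving_toLp (Fin 3)).integral_comp
    (MeasurableEquiv.toLp 2 (Fin 3 → ℝ)).measurableEmbedding]
  have h : ∀ y : Fin 3 → ℝ, |(WithLp.toLp 2 y : E₃) 0| * Real.exp (-‖(WithLp.toLp 2 y : E₃)‖ ^ 2)
      = ∏ i, (![fun t => |t| * Real.exp (-t ^ 2), fun t => Real.exp (-t ^ 2),
        fun t => Real.exp (-t ^ 2)] : Fin 3 → ℝ → ℝ) i (y i) := by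
    intro y
    rw [EuclideanSpace.norm_sq_eq]
    simp only [Fin.prod_univ_three, Fin.sum_univ_three, Real.norm_eq_abs, sq_abs, neg_add,
      Real.exp_add, Matrix.cons_val]
    ring
  simp only [h]
  rw [integral_fintype_prod_volume_eq_prod]
  have hg : ∫ x : ℝ, Real.exp (-x ^ 2) = √Real.pi := by simpa using integral_gaussian 1
  simp [Fin.prod_univ_three, integral_abs_mul_exp_neg_sq, hg, Real.mul_self_sqrt Real.pi_pos.le]

/-- The surface measure of the unit sphere of `ℝ³`. -/
noncomputable abbrev σ₂ : Measure (sphere (0 : E₃) 1) := (volume : Measure E₃).toSphere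

theorem integral_sphere_abs_inner {v : E₃} (hv : ‖v‖ = 1) :
    ∫ l, |inner ℝ v (l : E₃)| ∂σ₂ = 2 * Real.pi := by
  -- Polar coordinates split the Gaussian integral `π` into this integral times the radial factor `1
  -- / 2`.
  have h0 : ∫ l, |(l : E₃) 0| ∂σ₂ = 2 * Real.pi := by
    have h := integral_polar (E := E₃) (fun l => |l 0|) (fun r => r * Real.exp (-r ^ 2))
      (fun x => |x 0| * Real.exp (-‖x‖ ^ 2)) (by
        intro r l hr hl
        simp [norm_smul, hl, abs_mul, abs_of_pos hr]
        ring)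
    rw [integral_abs_coord_mul_exp_neg_norm_sq] at h
    have e : ∀ r : ℝ, r ^ (Module.finrank ℝ E₃ - 1) * (r * Real.exp (-r ^ 2))
        = r ^ 3 * Real.exp (-r ^ 2) := by
      intro r; simp; ring
    simp only [e, integral_cube_mul_exp_neg_sq] at h
    linarith
  have he : ‖(EuclideanSpace.single 0 1 : E₃)‖ = 1 := by simp
  -- This reflection carries the first basis vector to `v`.
  have hR := Submodule.reflection_sub (he.trans hv.symm)
  set R := (ℝ ∙ ((EuclideanSpace.single 0 1 : E₃) - v))ᗮ.reflection
  rw [← h0, ← integral_comp_sphereIsometry R fun x => |inner ℝ v x|]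
  refine integral_congr_ae (.of_forall fun l => ?_)
  beta_reduce
  rw [← hR, LinearIsometryEquiv.inner_map_map]
  rw [EuclideanSpace.inner_single_left]
  simp

theorem integral_sphere_neg (f : E₃ → ℝ) : ∫ l, f (-(l : E₃)) ∂σ₂ = ∫ l, f l ∂σ₂ := by
  simpa using integral_comp_sphereIsometry (LinearIsometryEquiv.neg ℝ (E := E₃)) f

theorem measurableSet_sphere_inner_pos (w : E₃) :
    MeasurableSet {l : sphere (0 : E₃) 1 | 0 < inner ℝ w (l : E₃)} :=
  (isOpen_lt continuous_const (by fun_prop)).measurableSet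

theorem integrable_ite_inner_pos {f : E₃ → ℝ} (hf : Continuous f) (w : E₃) :
    Integrable (fun l : sphere (0 : E₃) 1 => if 0 < inner ℝ w (l : E₃) then f l else 0) σ₂ := by
  have := (integrable_toSphere_of_continuous hf).indicator (measurableSet_sphere_inner_pos w)
  refine this.congr (.of_forall fun l => ?_)
  simp [indicator]

/-- The integrand `|v · l|` is even, so opposite hemispheres carry half of `2π` each; the great
circle between them is null. -/
theorem integral_hemisphere_abs_inner {v w : E₃} (hv : ‖v‖ = 1) (hw : ‖w‖ = 1) :
    ∫ l : sphere (0 : E₃) 1, (if 0 < inner ℝ w (l : E₃) then |inner ℝ v (l : E₃)| else 0) ∂σ₂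
      = Real.pi := by
  have hc : Continuous fun l : E₃ => |inner ℝ v l| := by fun_prop
  have h1 := integral_sphere_neg
    fun l => if 0 < inner ℝ w l then |inner ℝ v l| else 0
  have h2 : ∫ l, |inner ℝ v (l : E₃)| ∂σ₂
      = ∫ l : sphere (0 : E₃) 1, ((if 0 < inner ℝ w (l : E₃) then |inner ℝ v (l : E₃)| else 0)
        + if 0 < inner ℝ w (-(l : E₃)) then |inner ℝ v (-(l : E₃))| else 0) ∂σ₂ := by
    refine integral_congr_ae ?_
    have hn := toSphere_inner_eq_zero (v := w) (by rintro rfl; simp at hw)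
    filter_upwards [measure_eq_zero_iff_ae_notMem.1 hn] with l hl
    have hl : inner ℝ w (l : E₃) ≠ 0 := hl
    rcases lt_or_gt_of_ne hl with h | h
    · simp [h, h.not_gt]
    · simp [h, h.not_gt]
  rw [integral_add (integrable_ite_inner_pos hc w), h1, integral_sphere_abs_inner hv] at h2
  · linarith
  · have := integrable_ite_inner_pos (f := fun l => |inner ℝ v l|) hc (-w)
    simpa using this

theorem integral_sphere_inner (v : E₃) : ∫ l, inner ℝ v (l : E₃) ∂σ₂ = 0 := by
  have := integral_sphere_neg fun l => inner ℝ v l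
  simp only [inner_neg_right, integral_neg] at this
  linarith

/-- The half-turn about `w` preserves the hemisphere, and averaging `v · l` over it leaves `(v · w)
(w · l)`. So only the case `v = w` has to be integrated. -/
theorem integral_hemisphere_inner (v : E₃) {w : E₃} (hw : ‖w‖ = 1) :
    ∫ l : sphere (0 : E₃) 1, (if 0 < inner ℝ w (l : E₃) then inner ℝ v (l : E₃) else 0) ∂σ₂
      = Real.pi * inner ℝ v w := by
  have hww : inner ℝ w w = (1 : ℝ) := by simp [hw]
  have hcw : Continuous fun l : E₃ => inner ℝ w l := by fun_prop
  have hcv : Continuous fun l : E₃ => inner ℝ v l := by fun_prop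
  have h1 : ∫ l : sphere (0 : E₃) 1, (if 0 < inner ℝ w (l : E₃) then inner ℝ w (l : E₃) else 0) ∂σ₂
      = Real.pi := by
    rw [← integral_hemisphere_abs_inner hw hw]
    refine integral_congr_ae (.of_forall fun l => ?_)
    simp only
    split_ifs with h
    · rw [abs_of_pos h]
    · rfl
  have h2 := integral_comp_sphereIsometry (ℝ ∙ w).reflection
    fun l => if 0 < inner ℝ w l then inner ℝ v l else 0
  have h3 : ∀ l : E₃, (if 0 < inner ℝ w ((ℝ ∙ w).reflection l)
      then inner ℝ v ((ℝ ∙ w).reflection l) else 0)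
      = 2 * inner ℝ v w * (if 0 < inner ℝ w l then inner ℝ w l else 0)
        - (if 0 < inner ℝ w l then inner ℝ v l else 0) := by
    intro l
    rw [Submodule.reflection_singleton_apply]
    simp only [hw, inner_sub_right]
    have e : ∀ u : E₃, inner ℝ u ((2 : ℕ) • ((inner ℝ w l : ℝ) / ((1 : ℝ) : ℝ) ^ 2) • w)
        = 2 * inner ℝ w l * inner ℝ u w := by
      intro u
      rw [two_smul, inner_add_right, inner_smul_right]
      ring
    have e2 : 2 * inner ℝ w l * 1 - inner ℝ w l = (inner ℝ w l : ℝ) := by ring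
    simp only [RCLike.ofReal_real_eq_id, id_eq, e, hww, e2]
    split_ifs <;> ring
  simp only [h3] at h2
  rw [integral_sub ((integrable_ite_inner_pos hcw w).const_mul _) (integrable_ite_inner_pos hcv w),
    integral_const_mul, h1] at h2
  linarith

theorem max_zero_eq_half_add_abs (a : ℝ) : max 0 a = (a + |a|) / 2 := by
  rcases le_total 0 a with h | h
  · rw [max_eq_right h, abs_of_nonneg h]; ring
  · rw [max_eq_left h, abs_of_nonpos h]; ring

theorem integral_sphere_max_inner {v : E₃} (hv : ‖v‖ = 1) :
    ∫ l, max 0 (inner ℝ v (l : E₃)) ∂σ₂ = Real.pi := by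
  simp only [max_zero_eq_half_add_abs]
  rw [integral_div, integral_add, integral_sphere_inner, integral_sphere_abs_inner hv]
  · ring
  · exact integrable_toSphere_of_continuous (f := fun l => inner ℝ v l) (by fun_prop)
  · exact integrable_toSphere_of_continuous (f := fun l => |inner ℝ v l|) (by fun_prop)

/-- The weight that the cosine distribution around `v` gives to the hemisphere around `w`. -/
theorem integral_hemisphere_max_inner {v w : E₃} (hv : ‖v‖ = 1) (hw : ‖w‖ = 1) :
    ∫ l : sphere (0 : E₃) 1, (if 0 < inner ℝ w (l : E₃) then max 0 (inner ℝ v (l : E₃)) else 0) ∂σ₂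
      = Real.pi * ((1 + inner ℝ v w) / 2) := by
  have h : ∀ l : sphere (0 : E₃) 1,
      (if 0 < inner ℝ w (l : E₃) then max 0 (inner ℝ v (l : E₃)) else 0)
      = ((if 0 < inner ℝ w (l : E₃) then inner ℝ v (l : E₃) else 0)
        + (if 0 < inner ℝ w (l : E₃) then |inner ℝ v (l : E₃)| else 0)) / 2 := by
    intro l
    rw [max_zero_eq_half_add_abs]
    split_ifs <;> simp
  simp only [h]
  rw [integral_div, integral_add, integral_hemisphere_inner v hw,
    integral_hemisphere_abs_inner hv hw]
  · ring
  · exact integrable_ite_inner_pos (f := fun l => inner ℝ v l) (by fun_prop) w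
  · exact integrable_ite_inner_pos (f := fun l => |inner ℝ v l|) (by fun_prop) w

end TwoSphere

/-! ### Pauli components of qubit matrices and the Born rule -/

section Pauli

/-- The vector `(Tr(M σ_x), Tr(M σ_y), Tr(M σ_z))` of Pauli components of a matrix. -/
noncomputable def pauliVec (M : Matrix (Fin 2) (Fin 2) ℂ) : E₃ :=
  !₂[(Matrix.trace (M * !![0, 1; 1, 0])).re,
     (Matrix.trace (M * !![0, -Complex.I; Complex.I, 0])).re,
     (Matrix.trace (M * !![1, 0; 0, -1])).re]

theorem pauliVec_eq (M : Matrix (Fin 2) (Fin 2) ℂ) :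
    pauliVec M = !₂[(M 0 1).re + (M 1 0).re, (M 1 0).im - (M 0 1).im, (M 0 0).re - (M 1 1).re] := by
  ext i
  fin_cases i
  · simp [pauliVec, Matrix.trace, Matrix.mul_apply]
  · simp [pauliVec, Matrix.trace, Matrix.mul_apply]; ring
  · simp [pauliVec, Matrix.trace, Matrix.mul_apply]; ring

theorem blochVector_eq_pauliVec (ψ : PureState 2) : blochVector ψ = pauliVec ψ.matrix := rfl

theorem re_trace_fin_two (M : Matrix (Fin 2) (Fin 2) ℂ) :
    M.trace.re = (M 0 0).re + (M 1 1).re := by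
  simp [Matrix.trace]

theorem pauliVec_sum {ι : Type*} (s : Finset ι) (M : ι → Matrix (Fin 2) (Fin 2) ℂ) :
    pauliVec (∑ i ∈ s, M i) = ∑ i ∈ s, pauliVec (M i) := by
  classical
  induction s using Finset.induction_on with
  | empty =>
    ext i; fin_cases i <;> simp [pauliVec_eq]
  | insert a s ha ih =>
    rw [Finset.sum_insert ha, Finset.sum_insert ha, ← ih]
    ext i; fin_cases i <;> simp [pauliVec_eq] <;> ring

theorem pauliVec_one : pauliVec 1 = 0 := by
  ext i; fin_cases i <;> simp [pauliVec_eq]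

theorem Matrix.IsHermitian.entries_fin_two {M : Matrix (Fin 2) (Fin 2) ℂ} (hM : M.IsHermitian) :
    (M 0 0).im = 0 ∧ (M 1 1).im = 0 ∧ (M 1 0).re = (M 0 1).re ∧ (M 1 0).im = -(M 0 1).im := by
  have h := hM.apply
  have h00 := congrArg Complex.im (h 0 0)
  have h11 := congrArg Complex.im (h 1 1)
  have hr := congrArg Complex.re (h 1 0)
  have hi := congrArg Complex.im (h 1 0)
  simp at h00 h11 hr hi
  exact ⟨by linarith, by linarith, by linarith, by linarith⟩

/-- The Born rule in Pauli components. -/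
theorem re_trace_mul {A B : Matrix (Fin 2) (Fin 2) ℂ} (hA : A.IsHermitian) (hB : B.IsHermitian) :
    (A * B).trace.re
      = (A.trace.re * B.trace.re + inner ℝ (pauliVec A) (pauliVec B)) / 2 := by
  obtain ⟨a0, a1, ar, ai⟩ := hA.entries_fin_two
  obtain ⟨b0, b1, br, bi⟩ := hB.entries_fin_two
  simp only [re_trace_fin_two, pauliVec_eq, Matrix.mul_apply, Fin.sum_univ_two, PiLp.inner_apply,
    Fin.sum_univ_three, Complex.add_re, Complex.mul_re]
  simp only [a0, a1, ar, ai, b0, b1, br, bi, Matrix.cons_val, RCLike.inner_apply, conj_trivial]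
  ring

/-- Both sides are the squared difference of the two eigenvalues. -/
theorem norm_pauliVec_sq {A : Matrix (Fin 2) (Fin 2) ℂ} (hA : A.IsHermitian) :
    ‖pauliVec A‖ ^ 2 = A.trace.re ^ 2 - 4 * A.det.re := by
  obtain ⟨a0, a1, ar, ai⟩ := hA.entries_fin_two
  rw [EuclideanSpace.norm_sq_eq]
  simp only [re_trace_fin_two, pauliVec_eq, Matrix.det_fin_two,
    Fin.sum_univ_three, Complex.sub_re, Complex.mul_re, a0, a1, ar, ai, Matrix.cons_val,
    Real.norm_eq_abs, sq_abs]
  ring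

theorem Matrix.PosSemidef.norm_pauliVec_le {A : Matrix (Fin 2) (Fin 2) ℂ} (hA : A.PosSemidef) :
    ‖pauliVec A‖ ≤ A.trace.re := by
  have ht : 0 ≤ A.trace.re := (Complex.le_def.1 hA.trace_nonneg).1
  have hd : 0 ≤ A.det.re := (Complex.le_def.1 hA.det_nonneg).1
  have h := norm_pauliVec_sq hA.isHermitian
  exact abs_le_of_sq_le_sq' (by linarith) ht |>.2

/-- The entries of `A * A = A` give `(tr A - 1) · b = 0` for the off-diagonal entries `b`, and
likewise for the difference of the diagonal ones. So either `A` is a scalar, hence 0 or 1, or the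
trace is 1, the determinant vanishes and `norm_pauliVec_sq` gives norm 1. -/
theorem eq_of_isIdempotentElem_of_isHermitian {A : Matrix (Fin 2) (Fin 2) ℂ}
    (hA : A.IsHermitian) (h : A * A = A) :
    A.trace.re = 0 ∧ pauliVec A = 0 ∨ A.trace.re = 2 ∧ pauliVec A = 0 ∨
      A.trace.re = 1 ∧ ‖pauliVec A‖ = 1 := by
  obtain ⟨a0, a1, ar, ai⟩ := hA.entries_fin_two
  have e00 := congrArg Complex.re (congrFun (congrFun h 0) 0)
  have e11 := congrArg Complex.re (congrFun (congrFun h 1) 1)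
  have er := congrArg Complex.re (congrFun (congrFun h 0) 1)
  have ei := congrArg Complex.im (congrFun (congrFun h 0) 1)
  simp only [Matrix.mul_apply, Fin.sum_univ_two, Complex.add_re, Complex.mul_re, Complex.add_im,
    Complex.mul_im, a0, a1, ar, ai] at e00 e11 er ei
  by_cases ht : A.trace.re = 1
  · refine .inr (.inr ⟨ht, ?_⟩)
    have hs := norm_pauliVec_sq hA
    have hd : A.det.re = 0 := by
      rw [re_trace_fin_two] at ht
      simp only [Matrix.det_fin_two, Complex.sub_re, Complex.mul_re, a0, a1, ar, ai]
      have : (A 1 1).re = 1 - (A 0 0).re := by linarith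
      rw [this]
      linarith
    rw [ht, hd] at hs
    have := norm_nonneg (pauliVec A)
    nlinarith
  · rw [re_trace_fin_two] at ht
    have ht' : (A 0 0).re + (A 1 1).re - 1 ≠ 0 := sub_ne_zero.2 ht
    have hb : (A 0 1).re = 0 := by
      have : ((A 0 0).re + (A 1 1).re - 1) * (A 0 1).re = 0 := by linarith
      exact (mul_eq_zero.1 this).resolve_left ht'
    have hc : (A 0 1).im = 0 := by
      have : ((A 0 0).re + (A 1 1).re - 1) * (A 0 1).im = 0 := by linarith
      exact (mul_eq_zero.1 this).resolve_left ht'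
    have hz : (A 0 0).re - (A 1 1).re = 0 := by
      have : ((A 0 0).re + (A 1 1).re - 1) * ((A 0 0).re - (A 1 1).re) = 0 := by linarith
      exact (mul_eq_zero.1 this).resolve_left ht'
    have hv : pauliVec A = 0 := by
      ext i
      fin_cases i <;> simp [pauliVec_eq, ar, ai, hb, hc, hz]
    have h01 : (A 0 0).re * ((A 0 0).re - 1) = 0 := by
      rw [hb, hc] at e00; linarith
    rw [re_trace_fin_two]
    rcases mul_eq_zero.1 h01 with h | h
    · exact .inl ⟨by linarith, hv⟩
    · exact .inr (.inl ⟨by linarith, hv⟩)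

theorem PureState.posSemidef {d : ℕ} (ψ : PureState d) : ψ.matrix.PosSemidef := by
  obtain ⟨_, φ, -, rfl⟩ := ψ
  exact Matrix.posSemidef_vecMulVec_self_star φ

theorem PureState.trace_matrix {d : ℕ} (ψ : PureState d) : ψ.matrix.trace = 1 := by
  obtain ⟨_, φ, h, rfl⟩ := ψ
  change (Matrix.vecMulVec φ (star φ)).trace = 1
  rw [Matrix.trace_vecMulVec, dotProduct_comm, h]

theorem norm_blochVector (ψ : PureState 2) : ‖blochVector ψ‖ = 1 := by
  have h := norm_pauliVec_sq ψ.posSemidef.isHermitian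
  have hd : ψ.matrix.det = 0 := by
    obtain ⟨_, φ, -, rfl⟩ := ψ
    simp [PureState.matrix, Matrix.det_fin_two, Matrix.vecMulVec_apply]
    ring
  rw [ψ.trace_matrix, hd, ← blochVector_eq_pauliVec] at h
  have := norm_nonneg (blochVector ψ)
  norm_num at h
  rcases h with h | h <;> linarith

/-- The probability of an effect in a pure qubit state. -/
theorem re_trace_mul_pureState {A : Matrix (Fin 2) (Fin 2) ℂ} (hA : A.IsHermitian)
    (ψ : PureState 2) :
    (A * ψ.matrix).trace.re = (A.trace.re + inner ℝ (pauliVec A) (blochVector ψ)) / 2 := by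
  rw [re_trace_mul hA ψ.posSemidef.isHermitian, ψ.trace_matrix, blochVector_eq_pauliVec]
  simp

end Pauli

/-! ### Mean Bloch vectors and the quantum overlap -/

section Preparations

theorem bornProb_eq_sum {d k : ℕ} (M : POVM d k) (P : Preparation d) (x : Fin k) :
    bornProb M P x = ∑ i, (P.weight i : ℝ) * (M.effect x * (P.state i).matrix).trace.re := by
  simp only [bornProb, Preparation.densityMatrix, Finset.mul_sum, Matrix.trace_sum,
    Matrix.mul_smul, Matrix.trace_smul, Complex.re_sum]
  simp

theorem Preparation.sum_coe_weight {d : ℕ} (P : Preparation d) :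
    ∑ i, (P.weight i : ℝ) = 1 := by
  exact_mod_cast P.sum_weight

/-- The Bloch vector of a mixed preparation. -/
noncomputable def Preparation.meanBloch (P : Preparation 2) : E₃ :=
  ∑ i, (P.weight i : ℝ) • blochVector (P.state i)

theorem inner_meanBloch (P : Preparation 2) (l : E₃) :
    inner ℝ P.meanBloch l = ∑ i, (P.weight i : ℝ) * inner ℝ (blochVector (P.state i)) l := by
  simp [Preparation.meanBloch, sum_inner, inner_smul_left]

theorem bornProb_eq_meanBloch {k : ℕ} (M : POVM 2 k) (P : Preparation 2) (x : Fin k) :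
    bornProb M P x
      = ((M.effect x).trace.re + inner ℝ (pauliVec (M.effect x)) P.meanBloch) / 2 := by
  rw [bornProb_eq_sum, real_inner_comm, inner_meanBloch]
  simp only [re_trace_mul_pureState (M.posSemidef x).isHermitian, mul_div_assoc', mul_add,
    ← Finset.sum_div, Finset.sum_add_distrib, ← Finset.sum_mul, P.sum_coe_weight, one_mul]
  simp only [real_inner_comm]

theorem POVM.re_trace_effect_mul_nonneg {k : ℕ} (M : POVM 2 k) (ψ : PureState 2) (x : Fin k) :
    0 ≤ (M.effect x * ψ.matrix).trace.re := by
  rw [re_trace_mul_pureState (M.posSemidef x).isHermitian]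
  have h1 := (M.posSemidef x).norm_pauliVec_le
  have h2 := neg_le_of_abs_le (abs_real_inner_le_norm (pauliVec (M.effect x)) (blochVector ψ))
  rw [norm_blochVector, mul_one] at h2
  linarith

theorem POVM.sum_trace_effect {k : ℕ} (M : POVM 2 k) : ∑ x, (M.effect x).trace.re = 2 := by
  rw [← Complex.re_sum, ← Matrix.trace_sum, M.sum_effect]
  simp

theorem POVM.sum_pauliVec_effect {k : ℕ} (M : POVM 2 k) : ∑ x, pauliVec (M.effect x) = 0 := by
  rw [← pauliVec_sum, M.sum_effect, pauliVec_one]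

theorem POVM.sum_re_trace_effect_mul {k : ℕ} (M : POVM 2 k) (ψ : PureState 2) :
    ∑ x, (M.effect x * ψ.matrix).trace.re = 1 := by
  rw [← Complex.re_sum, ← Matrix.trace_sum, ← Finset.sum_mul, M.sum_effect, one_mul,
    ψ.trace_matrix, Complex.one_re]

theorem bornProb_nonneg {k : ℕ} (M : POVM 2 k) (P : Preparation 2) (x : Fin k) :
    0 ≤ bornProb M P x := by
  rw [bornProb_eq_sum]
  exact Finset.sum_nonneg fun i _ =>
    mul_nonneg (P.weight i).2 (M.re_trace_effect_mul_nonneg _ x)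

theorem sum_bornProb {k : ℕ} (M : POVM 2 k) (P : Preparation 2) : ∑ x, bornProb M P x = 1 := by
  simp only [bornProb_eq_sum]
  rw [Finset.sum_comm]
  simp only [← Finset.mul_sum, M.sum_re_trace_effect_mul, mul_one, P.sum_coe_weight]

/-- The common quantum overlap is a lower bound of the sums `∑ x, p(x | M, ρ_x)`. -/
theorem quantumOverlap_le {n : ℕ} (hn : 1 ≤ n) (P : Fin n → Preparation 2) (M : POVM 2 n) :
    quantumOverlap P ≤ ∑ x, bornProb M (P x) x := by
  have hn' : (0 : ℝ) < n := by exact_mod_cast hn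
  have key : ∀ M : POVM 2 n,
      (1 / (n : ℝ)) * ∑ x, ∑ k ∈ Finset.univ.erase x, bornProb M (P x) k
        = (1 / (n : ℝ)) * (n - ∑ x, bornProb M (P x) x) := by
    intro M
    congr 1
    have : ∀ x, ∑ k ∈ Finset.univ.erase x, bornProb M (P x) k = 1 - bornProb M (P x) x := by
      intro x
      rw [← sum_bornProb M (P x), ← Finset.add_sum_erase _ _ (Finset.mem_univ x)]
      ring
    simp [this]
  -- A real supremum dominates its family only if the family is bounded above.
  have hb : BddAbove (range fun M : POVM 2 n =>
      (1 / (n : ℝ)) * ∑ x, ∑ k ∈ Finset.univ.erase x, bornProb M (P x) k) := by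
    refine ⟨(1 / (n : ℝ)) * n, ?_⟩
    rintro _ ⟨M, rfl⟩
    simp only [key]
    have : 0 ≤ ∑ x, bornProb M (P x) x := Finset.sum_nonneg fun x _ => bornProb_nonneg _ _ _
    gcongr
    linarith
  have h := le_ciSup hb M
  simp only [key] at h
  rw [quantumOverlap, antiDistinguishability]
  simp only [key]
  have h' := mul_le_mul_of_nonneg_left h hn'.le
  have e : (n : ℝ) * (1 / n * (n - ∑ x, bornProb M (P x) x)) = n - ∑ x, bornProb M (P x) x := by
    field_simp
  rw [e] at h'
  linarith

end Preparations

/-! ### Spin measurements separate different density matrices -/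

section BinaryMeasurement

/-- The projector `(1 + w · σ) / 2`. -/
noncomputable def blochProjector (w : E₃) : Matrix (Fin 2) (Fin 2) ℂ :=
  !![((1 + w 2) / 2 : ℂ), (w 0 - w 1 * Complex.I) / 2; (w 0 + w 1 * Complex.I) / 2, (1 - w 2) / 2]

theorem isHermitian_blochProjector (w : E₃) : (blochProjector w).IsHermitian := by
  ext i j
  fin_cases i <;> fin_cases j <;> simp [blochProjector, Complex.ext_iff]

theorem trace_blochProjector (w : E₃) : (blochProjector w).trace.re = 1 := by
  simp [blochProjector]; ring

theorem pauliVec_blochProjector (w : E₃) : pauliVec (blochProjector w) = w := by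
  ext i
  fin_cases i <;> simp [blochProjector, pauliVec_eq] <;> ring

theorem blochProjector_add_neg (w : E₃) : blochProjector w + blochProjector (-w) = 1 := by
  ext i j
  fin_cases i <;> fin_cases j <;> simp [blochProjector] <;> ring

theorem posSemidef_blochProjector {w : E₃} (hw : ‖w‖ = 1) : (blochProjector w).PosSemidef := by
  have hs : (w 0) ^ 2 + (w 1) ^ 2 + (w 2) ^ 2 = 1 := by
    have := EuclideanSpace.norm_sq_eq w
    rw [hw] at this
    simpa [Fin.sum_univ_three] using this.symm
  have h : blochProjector w = (blochProjector w)ᴴ * blochProjector w := by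
    rw [(isHermitian_blochProjector w).eq]
    ext i j
    fin_cases i <;> fin_cases j <;>
      simp [blochProjector, Matrix.mul_apply, Complex.ext_iff] <;>
      constructor <;> nlinarith
  rw [h]
  exact Matrix.posSemidef_conjTranspose_mul_self _

/-- The projective measurement of the spin along `w`, with outcomes `j` and `k`. -/
noncomputable def spinMeasurement {n : ℕ} {j k : Fin n} (hjk : j ≠ k) {w : E₃} (hw : ‖w‖ = 1) :
    POVM 2 n where
  effect x := if x = j then blochProjector w else if x = k then blochProjector (-w) else 0
  posSemidef x := by
    split_ifs
    · exact posSemidef_blochProjector hw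
    · exact posSemidef_blochProjector (by rwa [norm_neg])
    · exact Matrix.PosSemidef.zero
  sum_effect := by
    rw [← blochProjector_add_neg w, Finset.sum_eq_add j k hjk]
    · simp [hjk.symm]
    · intro c _ hc
      simp [hc.1, hc.2]
    · simp
    · simp

/-- Preparations with maximal common quantum overlap have the same density matrix. -/
theorem meanBloch_eq_of_quantumOverlap_eq_one {n : ℕ} {P : Fin n → Preparation 2}
    (h : quantumOverlap P = 1) (j k : Fin n) : (P j).meanBloch = (P k).meanBloch := by
  by_contra hne
  have hjk : j ≠ k := fun h => hne (by rw [h])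
  have hn : 1 ≤ n := j.pos
  set u := (P k).meanBloch - (P j).meanBloch with hu
  have hu0 : u ≠ 0 := sub_ne_zero.2 (Ne.symm hne)
  have hpos : 0 < ‖u‖ := norm_pos_iff.2 hu0
  have hw : ‖‖u‖⁻¹ • u‖ = 1 := by rw [norm_smul, norm_inv, norm_norm, inv_mul_cancel₀ hpos.ne']
  -- The direction points from `P j` towards `P k`, so that outcome `j` is disfavoured by `P j` and
  -- `k` by `P k`: the sum of the two probabilities is `1 - ‖u‖ / 2`. All other effects vanish.
  have hle := quantumOverlap_le hn P (spinMeasurement hjk hw)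
  rw [h, Finset.sum_eq_add j k hjk] at hle
  · simp only [bornProb_eq_meanBloch, spinMeasurement, if_true, if_neg hjk.symm,
      trace_blochProjector, pauliVec_blochProjector, inner_neg_left] at hle
    have e : inner ℝ (‖u‖⁻¹ • u) (P k).meanBloch - inner ℝ (‖u‖⁻¹ • u) (P j).meanBloch = ‖u‖ := by
      rw [← inner_sub_right, ← hu, inner_smul_left, real_inner_self_eq_norm_sq]
      simp only [conj_trivial]
      field_simp
    linarith
  · intro c _ hc
    simp [bornProb, spinMeasurement, hc.1, hc.2]
  · simp
  · simp

end BinaryMeasurement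

/-! ### Components of every preparation in a common open hemisphere -/

section CommonHemisphere

/-- For almost every direction that makes an acute or right angle with the mean Bloch vector,
some component of the mixture lies in the open hemisphere around that direction. -/
theorem Preparation.ae_exists_inner_pos (P : Preparation 2) :
    ∀ᵐ l : sphere (0 : E₃) 1 ∂σ₂, 0 ≤ inner ℝ P.meanBloch (l : E₃) →
      ∃ i, P.weight i ≠ 0 ∧ 0 < inner ℝ (blochVector (P.state i)) (l : E₃) := by
  obtain ⟨i, -, hi⟩ : ∃ i ∈ Finset.univ, P.weight i ≠ 0 :=
    Finset.exists_ne_zero_of_sum_ne_zero (by rw [P.sum_weight]; exact one_ne_zero)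
  have hv : blochVector (P.state i) ≠ 0 := norm_ne_zero_iff.1 (by simp [norm_blochVector])
  filter_upwards [measure_eq_zero_iff_ae_notMem.1 (toSphere_inner_eq_zero hv)] with l hl hr
  have hl : inner ℝ (blochVector (P.state i)) (l : E₃) ≠ 0 := hl
  -- Otherwise no term of the mean is positive, and the term of `i` is strictly negative off its
  -- null great circle.
  by_contra! hneg
  have hterm : ∀ j ∈ Finset.univ,
      (P.weight j : ℝ) * inner ℝ (blochVector (P.state j)) (l : E₃) ≤ 0 := by
    intro j _
    by_cases hj : P.weight j = 0
    · simp [hj]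
    · exact mul_nonpos_of_nonneg_of_nonpos (P.weight j).2 (hneg j hj)
  have hlt : (P.weight i : ℝ) * inner ℝ (blochVector (P.state i)) (l : E₃) < 0 :=
    mul_neg_of_pos_of_neg (NNReal.coe_pos.2 (pos_iff_ne_zero.2 hi))
      (lt_of_le_of_ne (hneg i hi) hl)
  rw [inner_meanBloch] at hr
  exact absurd (Finset.sum_lt_sum hterm ⟨i, Finset.mem_univ i, by simpa using hlt⟩) (by simpa using hr)

/-- The weak inequality includes `r = 0`, the maximally mixed state, where every direction
qualifies. Otherwise the set contains a nonempty open hemisphere. -/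
theorem frequently_inner_nonneg (r : E₃) : ∃ᶠ l : sphere (0 : E₃) 1 in ae σ₂, 0 ≤ inner ℝ r (l : E₃) := by
  rw [frequently_ae_iff]
  by_cases hr : r = 0
  · subst hr
    simp [-Measure.toSphere_apply_univ]
  · have ho : IsOpen {l : sphere (0 : E₃) 1 | 0 < inner ℝ r (l : E₃)} :=
      isOpen_lt continuous_const (by fun_prop)
    have hpos : 0 < ‖r‖ := norm_pos_iff.2 hr
    have hne : {l : sphere (0 : E₃) 1 | 0 < inner ℝ r (l : E₃)}.Nonempty := by
      refine ⟨⟨‖r‖⁻¹ • r, by simp [norm_smul, hpos.ne']⟩, ?_⟩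
      simp only [mem_ofPred_eq, inner_smul_right, real_inner_self_eq_norm_sq]
      positivity
    exact (lt_of_lt_of_le (ho.measure_pos σ₂ hne) (measure_mono fun l (hl : 0 < inner ℝ r (l : E₃)) => hl.le)).ne'

/-- If the quantum overlap is maximal, a set of directions of positive measure has a component of
every preparation in its open hemisphere. -/
theorem frequently_exists_inner_pos {n : ℕ} {P : Fin n → Preparation 2}
    (h : quantumOverlap P = 1) :
    ∃ᶠ l : sphere (0 : E₃) 1 in ae σ₂, ∀ k, ∃ i, (P k).weight i ≠ 0 ∧
      0 < inner ℝ (blochVector ((P k).state i)) (l : E₃) := by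
  have hr : ∃ r : E₃, ∀ k, (P k).meanBloch = r := by
    rcases isEmpty_or_nonempty (Fin n) with hn | ⟨⟨k₀⟩⟩
    · exact ⟨0, fun k => hn.elim k⟩
    · exact ⟨_, fun k => meanBloch_eq_of_quantumOverlap_eq_one h k k₀⟩
  obtain ⟨r, hr⟩ := hr
  refine ((frequently_inner_nonneg r).and_eventually
    (ae_all_iff.2 fun k => (P k).ae_exists_inner_pos)).mono ?_
  rintro l ⟨h0, hl⟩ k
  exact hl k (by rwa [hr k])

end CommonHemisphere

/-! ### A model for all POVMs with one shared ontic state -/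

section Models

theorem EpistemicModel.prepDensity_ne_zero {d : ℕ} {E : EpistemicModel d} {P : Preparation d}
    {l : E.Ontic} {i : Fin P.size} (hi : P.weight i ≠ 0) (h : E.density (P.state i) l ≠ 0) :
    E.prepDensity P l ≠ 0 := fun h0 =>
  mul_ne_zero hi h ((Finset.sum_eq_zero_iff_of_nonneg fun _ _ => zero_le).1 h0 i
    (Finset.mem_univ i))

/-- Both sides of the reproduction condition are linear in the convex weights, so pure states
suffice. -/
theorem EpistemicModel.reproduces_of_pureState {k : ℕ} {E : EpistemicModel 2} {M : POVM 2 k}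
    (hE : ∀ ψ, Measurable (E.density ψ)) (ξ : Fin k → E.Ontic → ℝ≥0)
    (hξ : ∀ x, Measurable (ξ x)) (hsum : ∀ l, ∑ x, ξ x l = 1)
    (h : ∀ ψ x, ∫⁻ l, (E.density ψ l : ℝ≥0∞) * (ξ x l : ℝ≥0∞) ∂E.reference
      = ENNReal.ofReal (M.effect x * ψ.matrix).trace.re) :
    E.Reproduces M := by
  refine ⟨ξ, hξ, hsum, fun P x => ?_⟩
  have e : ∀ l, (E.prepDensity P l : ℝ≥0∞) * (ξ x l : ℝ≥0∞)
      = ∑ i, (P.weight i : ℝ≥0∞) * ((E.density (P.state i) l : ℝ≥0∞) * (ξ x l : ℝ≥0∞)) := by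
    intro l
    simp only [EpistemicModel.prepDensity, ENNReal.ofNNReal_finsetSum, ENNReal.coe_mul, Finset.sum_mul,
      mul_assoc]
  have hm : ∀ i, Measurable fun l =>
      (E.density (P.state i) l : ℝ≥0∞) * (ξ x l : ℝ≥0∞) := fun i =>
    (hE _).coe_nnreal_ennreal.mul (hξ x).coe_nnreal_ennreal
  simp only [e]
  rw [lintegral_finsetSum _ fun i _ => (hm i).const_mul _, bornProb_eq_sum,
    ENNReal.ofReal_sum_of_nonneg (f := fun i =>
      (P.weight i : ℝ) * (M.effect x * (P.state i).matrix).trace.re) fun i _ =>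
      mul_nonneg (P.weight i).2 (M.re_trace_effect_mul_nonneg _ x)]
  refine Finset.sum_congr rfl fun i _ => ?_
  rw [lintegral_const_mul _ (hm i), h, ENNReal.ofReal_mul (p := (P.weight i : ℝ)) (P.weight i).2, ENNReal.ofReal_coe_nnreal]

open scoped Classical in
/-- The model whose ontic states are the pure states and one further state `none`. A preparation
of `ψ` leads to `none` with probability `c ψ`, and to `ψ` otherwise. -/
noncomputable def sharedStateModel (c : PureState 2 → ℝ≥0) : EpistemicModel 2 where
  Ontic := Option (PureState 2)
  measurableSpace := ⊤
  reference := @Measure.count _ ⊤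
  density ψ l := l.elim (c ψ) fun φ => if φ = ψ then 1 - c ψ else 0

/-- The ontic space is uncountable, but the density of `ψ` lives on the two atoms `none` and `some
ψ`, so the integral against counting measure is a sum of two terms. -/
theorem lintegral_sharedStateModel (c : PureState 2 → ℝ≥0) (ψ : PureState 2)
    (f : Option (PureState 2) → ℝ≥0) :
    ∫⁻ l, ((sharedStateModel c).density ψ l : ℝ≥0∞) * (f l : ℝ≥0∞) ∂(sharedStateModel c).reference
      = ((c ψ * f none + (1 - c ψ) * f (some ψ) : ℝ≥0) : ℝ≥0∞) := by
  classical
  let _ : MeasurableSpace (Option (PureState 2)) := ⊤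
  change ∫⁻ l : Option (PureState 2), ((sharedStateModel c).density ψ l : ℝ≥0∞) * (f l : ℝ≥0∞)
    ∂Measure.count = _
  rw [lintegral_count, tsum_eq_sum (s := {none, some ψ})]
  · rw [Finset.sum_pair (by simp)]
    simp [sharedStateModel]
  · rintro (_ | φ) hφ
    · simp at hφ
    · have : φ ≠ ψ := by simpa using hφ
      simp [sharedStateModel, this]

/-- The model with a shared ontic state reproduces a measurement if a common distribution of the
outcomes is compatible with the statistics of all states that share the ontic state. -/
theorem sharedStateModel_reproduces {c : PureState 2 → ℝ≥0} (hc : ∀ ψ, c ψ < 1) {k : ℕ}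
    (M : POVM 2 k) (q : Fin k → ℝ≥0) (hq : ∑ x, q x = 1)
    (hle : ∀ ψ x, (c ψ * q x : ℝ) ≤ (M.effect x * ψ.matrix).trace.re) :
    (sharedStateModel c).Reproduces M := by
  have hc' : ∀ ψ, (0 : ℝ) < 1 - c ψ := fun ψ => sub_pos.2 (by exact_mod_cast hc ψ)
  -- The response at `some φ` solves `c φ * q x + (1 - c φ) * ξ = p(x | φ)`; by `hle` the solution
  -- is nonnegative, so `Real.toNNReal` truncates nothing.
  refine EpistemicModel.reproduces_of_pureState (fun ψ => measurable_from_top)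
    (fun x l => l.elim (q x) fun φ =>
      Real.toNNReal (((M.effect x * φ.matrix).trace.re - c φ * q x) / (1 - c φ)))
    (fun x => measurable_from_top) ?_ ?_
  · rintro (_ | φ)
    · exact hq
    · simp only [Option.elim_some]
      rw [← Real.toNNReal_sum_of_nonneg fun x _ =>
        div_nonneg (sub_nonneg.2 (hle φ x)) (hc' φ).le, ← Finset.sum_div, Finset.sum_sub_distrib,
        M.sum_re_trace_effect_mul, ← Finset.mul_sum]
      have : ∑ x, (q x : ℝ) = 1 := by exact_mod_cast hq
      rw [this, mul_one, div_self (hc' φ).ne', Real.toNNReal_one]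
  · intro ψ x
    refine (lintegral_sharedStateModel c ψ _).trans ?_
    rw [ENNReal.ofReal, ENNReal.coe_inj, ← NNReal.coe_inj,
      Real.coe_toNNReal _ (M.re_trace_effect_mul_nonneg ψ x)]
    simp only [Option.elim_none, Option.elim_some, NNReal.coe_add, NNReal.coe_mul,
      NNReal.coe_sub (hc ψ).le, NNReal.coe_one]
    rw [Real.coe_toNNReal _ (div_nonneg (sub_nonneg.2 (hle ψ x)) (hc' ψ).le),
      mul_div_cancel₀ _ (hc' ψ).ne']
    ring

theorem sharedStateModel_overlap_pos {c : PureState 2 → ℝ≥0} {n : ℕ} [NeZero n]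
    {P : Fin n → Preparation 2}
    (h : ∀ k, ∃ i, (P k).weight i ≠ 0 ∧ c ((P k).state i) ≠ 0) :
    (sharedStateModel c).overlap P ≠ 0 := by
  let _ : MeasurableSpace (Option (PureState 2)) := ⊤
  change ∫⁻ l : Option (PureState 2), ⨅ k, ((sharedStateModel c).prepDensity (P k) l : ℝ≥0∞)
    ∂Measure.count ≠ 0
  rw [lintegral_count, Ne, ENNReal.tsum_eq_zero]
  intro h0
  obtain ⟨k, hk⟩ := exists_eq_ciInf_of_finite
    (f := fun k => ((sharedStateModel c).prepDensity (P k) none : ℝ≥0∞))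
  rw [h0 none, ENNReal.coe_eq_zero] at hk
  obtain ⟨i, hi, hc⟩ := h k
  exact EpistemicModel.prepDensity_ne_zero (E := sharedStateModel c) (l := (none : Option _)) hi hc hk

/-- Pure states in a common open hemisphere are not antidistinguishable: every measurement has
outcome distributions in these states with a common part that is bounded below. -/
theorem exists_common_outcome_bound {n : ℕ} [NeZero n] (φ : Fin n → PureState 2) {l : E₃}
    (hl : ‖l‖ = 1) (h : ∀ j, 0 < inner ℝ (blochVector (φ j)) l) :
    ∃ ε : ℝ≥0, 0 < ε ∧ ε < 1 ∧ ∀ (k : ℕ) (M : POVM 2 k), ∃ q : Fin k → ℝ≥0, ∑ x, q x = 1 ∧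
      ∀ j x, (ε * q x : ℝ) ≤ (M.effect x * (φ j).matrix).trace.re := by
  obtain ⟨j₀, hj₀⟩ := Finite.exists_min fun j => inner ℝ (blochVector (φ j)) l
  set a : ℝ := inner ℝ (blochVector (φ j₀)) l with ha
  have ha0 : 0 < a := h j₀
  have ha1 : a ≤ 1 := by
    have := real_inner_le_norm (blochVector (φ j₀)) l
    rwa [norm_blochVector, hl, one_mul] at this
  -- Since `v · l ≥ a`, the squared norm is at most `1 - a ^ 2 ≤ (1 - a ^ 2 / 2) ^ 2`.
  have hdist : ∀ j, ‖blochVector (φ j) - a • l‖ ≤ 1 - a ^ 2 / 2 := by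
    intro j
    have e := norm_sub_sq_real (blochVector (φ j)) (a • l)
    rw [norm_blochVector, norm_smul, hl, inner_smul_right, Real.norm_of_nonneg ha0.le] at e
    have := hj₀ j
    refine abs_le_of_sq_le_sq' ?_ (by nlinarith) |>.2
    nlinarith [mul_le_mul_of_nonneg_left this ha0.le, sq_nonneg (a ^ 2)]
  refine ⟨⟨a ^ 2 / 2, by positivity⟩, NNReal.coe_pos.1 (by change 0 < a ^ 2 / 2; positivity),
    NNReal.coe_lt_coe.1 (by change a ^ 2 / 2 < 1; nlinarith), fun k M => ?_⟩
  -- Writing `v = a l + (v - a l)` gives a lower bound independent of `j`. Summed over the outcomes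
  -- it is `a ^ 2 / 2`, because the traces add up to 2 and the Pauli vectors cancel.
  have hlow : ∀ j x, ((M.effect x).trace.re * (a ^ 2 / 2)
      + a * inner ℝ (pauliVec (M.effect x)) l) / 2 ≤ (M.effect x * (φ j).matrix).trace.re := by
    intro j x
    rw [re_trace_mul_pureState (M.posSemidef x).isHermitian]
    have h1 := (M.posSemidef x).norm_pauliVec_le
    have h2 := neg_le_of_abs_le (abs_real_inner_le_norm (pauliVec (M.effect x))
      (blochVector (φ j) - a • l))
    rw [inner_sub_right, inner_smul_right] at h2
    have h3 : ‖pauliVec (M.effect x)‖ * ‖blochVector (φ j) - a • l‖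
        ≤ (M.effect x).trace.re * (1 - a ^ 2 / 2) :=
      mul_le_mul h1 (hdist j) (norm_nonneg _) ((norm_nonneg _).trans h1)
    linarith
  -- The common part is the minimum `m x` over the states, and `q` is `m` normalised; its total mass
  -- is at least `ε`, whence `ε * q ≤ m`.
  choose g hg using fun x => Finite.exists_min fun j => (M.effect x * (φ j).matrix).trace.re
  set m : Fin k → ℝ := fun x => (M.effect x * (φ (g x)).matrix).trace.re with hm
  have hm0 : ∀ x, 0 ≤ m x := fun x => M.re_trace_effect_mul_nonneg _ x
  have hsum : a ^ 2 / 2 ≤ ∑ x, m x := by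
    calc a ^ 2 / 2 = ∑ x, ((M.effect x).trace.re * (a ^ 2 / 2)
          + a * inner ℝ (pauliVec (M.effect x)) l) / 2 := by
          rw [← Finset.sum_div, Finset.sum_add_distrib, ← Finset.sum_mul, ← Finset.mul_sum,
            ← sum_inner, M.sum_trace_effect, M.sum_pauliVec_effect, inner_zero_left]
          ring
      _ ≤ _ := Finset.sum_le_sum fun x _ => hlow _ x
  have hpos : 0 < ∑ x, m x := lt_of_lt_of_le (by positivity) hsum
  refine ⟨fun x => Real.toNNReal (m x / ∑ y, m y), ?_, fun j x => ?_⟩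
  · rw [← Real.toNNReal_sum_of_nonneg fun x _ => div_nonneg (hm0 x) hpos.le, ← Finset.sum_div,
      div_self hpos.ne', Real.toNNReal_one]
  · refine le_trans ?_ (hg x j)
    rw [Real.coe_toNNReal _ (div_nonneg (hm0 x) hpos.le)]
    change a ^ 2 / 2 * (m x / ∑ y, m y) ≤ m x
    rw [mul_div_assoc', div_le_iff₀ hpos, mul_comm]
    exact mul_le_mul_of_nonneg_left hsum (hm0 x)

theorem not_fullyNonEpistemic_allMeasurements {n : ℕ} [NeZero n] (P : Fin n → Preparation 2) :
    ¬ FullyNonEpistemic (allMeasurements 2) P := by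
  classical
  rintro ⟨hQ, hE⟩
  obtain ⟨l, hl⟩ := (frequently_exists_inner_pos hQ).exists
  choose i hi hpos using hl
  obtain ⟨ε, hε0, hε1, hε⟩ := exists_common_outcome_bound (fun k => (P k).state (i k))
    (norm_eq_of_mem_sphere l) hpos
  set S : Set (PureState 2) := range fun k => (P k).state (i k)
  -- Only the selected states share `none`; any other state stays on its private ontic state with
  -- certainty, so it puts no constraint on `q`.
  set c : PureState 2 → ℝ≥0 := S.indicator fun _ => ε with hc
  have hc1 : ∀ ψ, c ψ < 1 := by
    intro ψ
    rw [hc, indicator_apply]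
    split_ifs
    · exact hε1
    · exact one_pos
  refine sharedStateModel_overlap_pos (c := c) (P := P) (fun k => ⟨i k, hi k, ?_⟩)
    (hE _ ⟨fun ψ => measurable_from_top, fun ψ => ?_, fun k M _ => ?_⟩)
  · rw [hc, indicator_of_mem (mem_range_self k)]
    exact hε0.ne'
  · have := lintegral_sharedStateModel c ψ fun _ => 1
    simp only [ENNReal.coe_one, mul_one] at this
    rw [this, add_tsub_cancel_of_le (hc1 ψ).le, ENNReal.coe_one]
  · obtain ⟨q, hq, hle⟩ := hε k M
    refine sharedStateModel_reproduces hc1 M q hq fun ψ x => ?_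
    rw [hc]
    by_cases hψ : ψ ∈ S
    · obtain ⟨j, rfl⟩ := hψ
      rw [indicator_of_mem (mem_range_self j)]
      exact hle j x
    · rw [indicator_of_notMem hψ]
      simpa using M.re_trace_effect_mul_nonneg ψ x

end Models

/-! ### The Kochen–Specker model and projective measurements -/

section KochenSpecker

theorem kochenSpecker_measurable_density (ψ : PureState 2) :
    Measurable (kochenSpecker.density ψ) := by
  change Measurable fun l : sphere (0 : E₃) 1 =>
    Real.toNNReal ((1 / Real.pi) * max 0 (inner ℝ (blochVector ψ) (l : E₃)))
  exact Continuous.measurable (by fun_prop)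

theorem kochenSpecker_lintegral_density (ψ : PureState 2) :
    ∫⁻ l, (kochenSpecker.density ψ l : ℝ≥0∞) ∂kochenSpecker.reference = 1 := by
  change ∫⁻ l : sphere (0 : E₃) 1,
    ENNReal.ofReal ((1 / Real.pi) * max 0 (inner ℝ (blochVector ψ) (l : E₃))) ∂σ₂ = 1
  rw [← ofReal_integral_eq_lintegral_ofReal, integral_const_mul,
    integral_sphere_max_inner (norm_blochVector ψ), one_div, inv_mul_cancel₀ Real.pi_ne_zero,
    ENNReal.ofReal_one]
  · exact integrable_toSphere_of_continuous
      (f := fun l => (1 / Real.pi) * max 0 (inner ℝ (blochVector ψ) l)) (by fun_prop)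
  · exact .of_forall fun l => by positivity

theorem kochenSpecker_lintegral_hemisphere (ψ : PureState 2) {w : E₃} (hw : ‖w‖ = 1) :
    ∫⁻ l : sphere (0 : E₃) 1, (kochenSpecker.density ψ l : ℝ≥0∞)
      * ((if 0 < inner ℝ w (l : E₃) then 1 else 0 : ℝ≥0) : ℝ≥0∞) ∂σ₂
      = ENNReal.ofReal ((1 + inner ℝ w (blochVector ψ)) / 2) := by
  have e : ∀ l : sphere (0 : E₃) 1, (kochenSpecker.density ψ l : ℝ≥0∞)
      * ((if 0 < inner ℝ w (l : E₃) then 1 else 0 : ℝ≥0) : ℝ≥0∞)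
      = ENNReal.ofReal ((1 / Real.pi) *
        if 0 < inner ℝ w (l : E₃) then max 0 (inner ℝ (blochVector ψ) (l : E₃)) else 0) := by
    intro l
    split_ifs
    · simp only [ENNReal.coe_one, mul_one]
      rfl
    · simp
  simp only [e]
  rw [← ofReal_integral_eq_lintegral_ofReal, integral_const_mul,
    integral_hemisphere_max_inner (norm_blochVector ψ) hw, ← mul_assoc, one_div,
    inv_mul_cancel₀ Real.pi_ne_zero, one_mul, real_inner_comm]
  · exact (integrable_ite_inner_pos
      (f := fun l => max 0 (inner ℝ (blochVector ψ) l)) (by fun_prop) w).const_mul _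
  · exact .of_forall fun l => by
      simp only [Pi.zero_apply]
      split_ifs <;> positivity

/-- This is the total mass 1 minus the open hemisphere. Taking the complement, not the opposite open
hemisphere, lets the two responses sum to 1 on the great circle as well. -/
theorem kochenSpecker_lintegral_hemisphere_compl (ψ : PureState 2) {w : E₃} (hw : ‖w‖ = 1) :
    ∫⁻ l : sphere (0 : E₃) 1, (kochenSpecker.density ψ l : ℝ≥0∞)
      * ((if 0 < inner ℝ w (l : E₃) then 0 else 1 : ℝ≥0) : ℝ≥0∞) ∂σ₂
      = ENNReal.ofReal ((1 - inner ℝ w (blochVector ψ)) / 2) := by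
  have hm : Measurable fun l : sphere (0 : E₃) 1 => (kochenSpecker.density ψ l : ℝ≥0∞)
      * ((if 0 < inner ℝ w (l : E₃) then 1 else 0 : ℝ≥0) : ℝ≥0∞) :=
    (kochenSpecker_measurable_density ψ).coe_nnreal_ennreal.mul
      (Measurable.ite (measurableSet_sphere_inner_pos w) measurable_const
        measurable_const).coe_nnreal_ennreal
  have hadd := lintegral_add_right (μ := σ₂) (fun l : sphere (0 : E₃) 1 =>
    (kochenSpecker.density ψ l : ℝ≥0∞)
      * ((if 0 < inner ℝ w (l : E₃) then 0 else 1 : ℝ≥0) : ℝ≥0∞)) hm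
  have e : ∀ l : sphere (0 : E₃) 1, (kochenSpecker.density ψ l : ℝ≥0∞)
      * ((if 0 < inner ℝ w (l : E₃) then 0 else 1 : ℝ≥0) : ℝ≥0∞)
      + (kochenSpecker.density ψ l : ℝ≥0∞)
      * ((if 0 < inner ℝ w (l : E₃) then 1 else 0 : ℝ≥0) : ℝ≥0∞)
      = (kochenSpecker.density ψ l : ℝ≥0∞) := by
    intro l
    split_ifs <;> simp
  simp only [e] at hadd
  have htot : ∫⁻ l : sphere (0 : E₃) 1, (kochenSpecker.density ψ l : ℝ≥0∞) ∂σ₂ = 1 :=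
    kochenSpecker_lintegral_density ψ
  have hin := neg_le_of_abs_le (abs_real_inner_le_norm w (blochVector ψ))
  rw [norm_blochVector, hw, mul_one] at hin
  rw [htot, kochenSpecker_lintegral_hemisphere ψ hw] at hadd
  rw [ENNReal.eq_sub_of_add_eq ENNReal.ofReal_ne_top hadd.symm, ← ENNReal.ofReal_one,
    ← ENNReal.ofReal_sub _ (by linarith)]
  congr 1
  ring

/-- A projective qubit measurement is either trivial or a spin measurement. -/
theorem POVM.IsProjective.cases_two {k : ℕ} {M : POVM 2 k} (hM : M.IsProjective) :
    (∃ a, (M.effect a).trace.re = 2 ∧ pauliVec (M.effect a) = 0 ∧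
      ∀ x, x ≠ a → (M.effect x).trace.re = 0 ∧ pauliVec (M.effect x) = 0) ∨
    ∃ a b, ∃ w : E₃, a ≠ b ∧ ‖w‖ = 1 ∧
      (M.effect a).trace.re = 1 ∧ pauliVec (M.effect a) = w ∧
      (M.effect b).trace.re = 1 ∧ pauliVec (M.effect b) = -w ∧
      ∀ x, x ≠ a → x ≠ b → (M.effect x).trace.re = 0 ∧ pauliVec (M.effect x) = 0 := by
  -- The traces lie in `{0, 1, 2}` and sum to 2, so either one effect has trace 2 or exactly two
  -- have trace 1; in the latter case the vanishing sum of Pauli vectors makes these two opposite.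
  have hcl := fun x =>
    eq_of_isIdempotentElem_of_isHermitian (M.posSemidef x).isHermitian (hM x)
  have ht : ∀ x, 0 ≤ (M.effect x).trace.re := fun x =>
    (norm_nonneg _).trans (M.posSemidef x).norm_pauliVec_le
  have hz : ∀ x, (M.effect x).trace.re = 0 → pauliVec (M.effect x) = 0 := fun x hx => by
    have := (M.posSemidef x).norm_pauliVec_le
    rw [hx] at this
    exact norm_le_zero_iff.1 this
  have hsum := M.sum_trace_effect
  by_cases h2 : ∃ a, (M.effect a).trace.re = 2
  · obtain ⟨a, ha⟩ := h2
    refine .inl ⟨a, ha, ?_, ?_⟩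
    · rcases hcl a with h | h | h
      · exact h.2
      · exact h.2
      · linarith [h.1]
    · rw [← Finset.add_sum_erase _ _ (Finset.mem_univ a), ha, add_eq_left,
        Finset.sum_eq_zero_iff_of_nonneg fun x _ => ht x] at hsum
      intro x hx
      have := hsum x (by simp [hx])
      exact ⟨this, hz x this⟩
  · push Not at h2
    have h1 : ∀ x, (M.effect x).trace.re ≠ 0 →
        (M.effect x).trace.re = 1 ∧ ‖pauliVec (M.effect x)‖ = 1 := by
      intro x hx
      rcases hcl x with h | h | h
      · exact absurd h.1 hx
      · exact absurd h.1 (h2 x)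
      · exact h
    obtain ⟨a, -, ha⟩ : ∃ a ∈ Finset.univ, (M.effect a).trace.re ≠ 0 :=
      Finset.exists_ne_zero_of_sum_ne_zero (by rw [hsum]; norm_num)
    have hta := (h1 a ha).1
    have hrest : ∑ x ∈ Finset.univ.erase a, (M.effect x).trace.re = 1 := by
      rw [← Finset.add_sum_erase _ _ (Finset.mem_univ a), hta] at hsum
      linarith
    obtain ⟨b, hb, hb0⟩ : ∃ b ∈ Finset.univ.erase a, (M.effect b).trace.re ≠ 0 :=
      Finset.exists_ne_zero_of_sum_ne_zero (by rw [hrest]; norm_num)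
    have htb := (h1 b hb0).1
    rw [← Finset.add_sum_erase _ _ hb, htb, add_eq_left,
      Finset.sum_eq_zero_iff_of_nonneg fun x _ => ht x] at hrest
    have hab : b ≠ a := Finset.ne_of_mem_erase hb
    have hx : ∀ x, x ≠ a → x ≠ b → (M.effect x).trace.re = 0 ∧ pauliVec (M.effect x) = 0 := by
      intro x hxa hxb
      have := hrest x (by simp [hxa, hxb])
      exact ⟨this, hz x this⟩
    refine .inr ⟨a, b, _, hab.symm, (h1 a ha).2, hta, rfl, htb, ?_, hx⟩
    have hv := M.sum_pauliVec_effect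
    rw [Finset.sum_eq_add a b hab.symm (fun c _ hc => (hx c hc.1 hc.2).2) (by simp) (by simp)] at hv
    exact (neg_eq_of_add_eq_zero_right hv).symm

/-- The responses are deterministic: constant for a trivial measurement, decided by the sign of `w ·
l` for a spin measurement. -/
theorem kochenSpecker_reproduces {k : ℕ} {M : POVM 2 k} (hM : M.IsProjective) :
    kochenSpecker.Reproduces M := by
  have htr : ∀ ψ : PureState 2, ∀ x, (M.effect x * ψ.matrix).trace.re
      = ((M.effect x).trace.re + inner ℝ (pauliVec (M.effect x)) (blochVector ψ)) / 2 :=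
    fun ψ x => re_trace_mul_pureState (M.posSemidef x).isHermitian ψ
  rcases hM.cases_two with ⟨a, ha, hva, hx⟩ | ⟨a, b, w, hab, hw, ha, hva, hb, hvb, hx⟩
  · refine EpistemicModel.reproduces_of_pureState kochenSpecker_measurable_density
      (fun x _ => if x = a then 1 else 0) (fun x => measurable_const) (fun l => by simp) ?_
    intro ψ x
    by_cases hxa : x = a
    · subst hxa
      simp [htr, ha, hva, kochenSpecker_lintegral_density]
    · simp [htr, hxa, hx x hxa]
  · refine EpistemicModel.reproduces_of_pureState kochenSpecker_measurable_density
      (fun x (l : sphere (0 : E₃) 1) => if x = a then (if 0 < inner ℝ w (l : E₃) then 1 else 0)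
        else if x = b then (if 0 < inner ℝ w (l : E₃) then 0 else 1) else 0) ?_ ?_ ?_
    · intro x
      have hms := measurableSet_sphere_inner_pos w
      split_ifs
      · exact Measurable.ite hms measurable_const measurable_const
      · exact Measurable.ite hms measurable_const measurable_const
      · exact measurable_const
    · intro l
      rw [Finset.sum_eq_add a b hab (fun c _ hc => by simp [hc.1, hc.2]) (by simp) (by simp)]
      simp only [if_true, if_neg hab.symm]
      split_ifs <;> simp
    · intro ψ x
      by_cases hxa : x = a
      · subst hxa
        simp only [if_true, htr, ha, hva]
        exact kochenSpecker_lintegral_hemisphere ψ hw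
      · by_cases hxb : x = b
        · subst hxb
          simp only [if_true, if_neg hxa, htr, hb, hvb, inner_neg_left, ← sub_eq_add_neg]
          exact kochenSpecker_lintegral_hemisphere_compl ψ hw
        · simp [htr, hxa, hxb, hx x hxa hxb]

theorem kochenSpecker_isOntologicalModel :
    kochenSpecker.IsOntologicalModel (projectiveMeasurements 2) where
  measurable_density := kochenSpecker_measurable_density
  lintegral_density := kochenSpecker_lintegral_density
  reproduces _ _ hM := kochenSpecker_reproduces hM

theorem kochenSpecker_overlap_pos {n : ℕ} [NeZero n] {P : Fin n → Preparation 2}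
    (h : quantumOverlap P = 1) : 0 < kochenSpecker.overlap P := by
  rw [pos_iff_ne_zero]
  intro h0
  have hm : ∀ k, Measurable fun l => (kochenSpecker.prepDensity (P k) l : ℝ≥0∞) := fun k =>
    (Finset.measurable_fun_sum _ fun i _ =>
      (kochenSpecker_measurable_density _).const_mul _).coe_nnreal_ennreal
  -- Zero overlap makes the minimum of the densities vanish almost everywhere, hence also at some
  -- `l` where every preparation has a component with positive density.
  rw [EpistemicModel.overlap, lintegral_eq_zero_iff (.iInf hm)] at h0
  obtain ⟨l, hl, h0⟩ : ∃ l : kochenSpecker.Ontic, _ :=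
    ((frequently_exists_inner_pos h).and_eventually h0).exists
  obtain ⟨k, hk⟩ := exists_eq_ciInf_of_finite
    (f := fun k => (kochenSpecker.prepDensity (P k) l : ℝ≥0∞))
  rw [show ⨅ k, (kochenSpecker.prepDensity (P k) l : ℝ≥0∞) = 0 from h0,
    ENNReal.coe_eq_zero] at hk
  obtain ⟨i, hi, hpos⟩ := hl k
  refine EpistemicModel.prepDensity_ne_zero hi (ne_of_gt ?_) hk
  exact Real.toNNReal_pos.2
    (mul_pos (one_div_pos.2 Real.pi_pos) (lt_of_lt_of_le hpos (le_max_right _ _)))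

end KochenSpecker

theorem theorem4 (n : ℕ) (hn : 1 ≤ n) (P : Fin n → Preparation 2) :
    ¬ FullyNonEpistemic (allMeasurements 2) P ∧
    ¬ FullyNonEpistemic (projectiveMeasurements 2) P ∧
    kochenSpecker.IsOntologicalModel (projectiveMeasurements 2) ∧
    (quantumOverlap P = 1 → 0 < kochenSpecker.overlap P) := by
  have : NeZero n := ⟨by lia⟩
  exact ⟨not_fullyNonEpistemic_allMeasurements P,
    fun h => (kochenSpecker_overlap_pos h.1).ne' (h.2 _ kochenSpecker_isOntologicalModel),
    kochenSpecker_isOntologicalModel, kochenSpecker_overlap_pos⟩
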